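/- **Setting.** There are $n$ replicas, of which at most $f$ are faulty (Byzantine), $n>3f$; write $\mathbf{nf}=n-f$. Communication is authenticated: a message received from (or signed by) a non-faulty replica was sent by it. Messages may be lost, delayed and reordered. Communication is *reliable from time $g$ on* if, for some $\Delta$, every message sent at a time $t\ge g$ by a non-faulty replica to a non-faulty replica arrives by time $t+\Delta$. The system runs $m\le n$ instances $\mathcal I_i$ of a Byzantine commit algorithm; the $i$-th replica is the primary of $\mathcal I_i$ and proposes one transaction per round. *Assumption on the commit algorithm.* The states of non-faulty replicas are well-formed, and if a non-faulty replica has accepted a transaction $T$ in round $\rho$, then from that time on the proposal $(\rho,T)$ can be recovered from the states of any $\mathbf{nf}-f$ non-faulty replicas. *Coordinating protocol.* For each $i$ there is a separate run of a primary-backup consensus protocol $P$ (with views, each having a leader) that decides on an operation $\mathrm{stop}(i;E)$. $P$ is any such protocol that provides consensus when at most $f$ replicas are faulty: no two non-faulty replicas accept different operations; non-faulty replicas accept only valid operations; and, if communication is reliable from some time on, (a) an operation accepted by one non-faulty replica is eventually accepted by all of them, and (b) if from some time on every non-faulty replica that has not yet accepted an operation runs its timer for the decision and, whenever it is the leader of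 its current view, has proposed a valid operation, then all non-faulty replicas eventually accept an operation. *Recovery protocol for $\mathcal I_i$ (followed by all non-faulty replicas).* A failure message $\mathrm{Failure}(i,\rho,P)$ is valid if $P$ is well-formed and $\rho$ is not before the round in which $\mathcal I_i$ last started. 1. A replica that detects failure of the primary of $\mathcal I_i$ in a round $\rho$ halts $\mathcal I_i$ and broadcasts $\mathrm{Failure}(i,\rho,P)$, where $P$ is its state of $\mathcal I_i$; it repeats the broadcast until it accepts a stop operation. It sends no other failure messages. 2. A replica that has received valid failure messages for $i$ from $f+1$ distinct replicas detects failure of the primary of $\mathcal I_i$, unless it has already done so or has already accepted a stop operation. 3. A replica that has received valid failure messages for $i$ from $\mathbf{nf}$ distinct replicas and has not accepted a stop operation runs its timer for a stop operation and, when it is the leader in $P$, proposes $\mathrm{stop}(i;E)$ with $E$ a set of such messages from $\mathbf{nf}$ distinct replicas. An operation $\mathrm{stop}(i;E)$ is valid if $E$ is a set of valid, genuinely signed failure messages for $i$ from $\mathbf{nf}$ distinct replicas. 4. A replica that accepts $\mathrm{stop}(i;E)$ via $P$ recovers from $E$ the state of $\mathcal I_i$: the set of all proposals that can be recovered from the states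 reported in $E$ by some $\mathbf{nf}-f$ of its senders, together with the round $\rho'+2^{k}$ in which $\mathcal I_i$ may resume, where $\rho'$ is the last round of a recovered proposal (if there is one) and $k$ is the number of stop operations accepted for $\mathcal I_i$ so far. **Theorem.** Suppose that $n>3f$, that $\mathcal I_i$ has a confirmed failure, i.e. some non-faulty replica receives valid failure messages for $i$ from $\mathbf{nf}$ distinct replicas, and that communication is reliable from some time on. Then there is a single state $S$ of $\mathcal I_i$ such that, from some time on, every non-faulty replica has recovered exactly the state $S$; and $S$ includes every proposal that any non-faulty replica accepts in $\mathcal I_i$. In particular, if the last proposal of the primary of $\mathcal I_i$ accepted by a non-faulty replica was in round $\rho$, then $S$ includes all proposals accepted by non-faulty replicas before or at round $\rho$. -/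

import Mathlib

/-!
# Concurrent Byzantine commit with wait-free recovery: the model

Replicas are the elements of `Fin n`; a finite set `faulty` of at most `f` of them is Byzantine and
is not constrained at all, apart from the unforgeability of signatures of non-faulty replicas.
Write `nf = n - f`.  Time is a global discrete clock `ℕ` that no replica can read; protocols are
given by the sets of their possible runs.
-/

namespace RCC

/-! ### Communication -/

/-- A record of point-to-point communication with payloads in `M`.
`sent s r m t`: replica `s` sends `m` to `r` at time `t`;
`received s r m t`: at time `t`, replica `r` receives `m`, carrying the authentication of `s`. -/
structure Network (n : ℕ) (M : Type*) where
  sent : Fin n → Fin n → M → ℕ → Prop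
  received : Fin n → Fin n → M → ℕ → Prop

namespace Network

variable {n : ℕ} {M : Type*}

/-- Authenticated communication: nothing is received from a non-faulty replica that it did not send
before.  Messages may be lost, delayed, duplicated and reordered arbitrarily. -/
def Authenticated (N : Network n M) (faulty : Finset (Fin n)) : Prop :=
  ∀ s ∉ faulty, ∀ r m t, N.received s r m t → ∃ t' ≤ t, N.sent s r m t'

/-- Communication is reliable, with maximal delay `Δ`, from time `g` on: all messages sent at or
after `g` by non-faulty replicas arrive at their non-faulty destination within time `Δ`. -/
def ReliableFrom (N : Network n M) (faulty : Finset (Fin n)) (g Δ : ℕ) : Prop :=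
  ∀ s ∉ faulty, ∀ r ∉ faulty, ∀ m, ∀ t ≥ g, N.sent s r m t →
    ∃ t', t ≤ t' ∧ t' ≤ t + Δ ∧ N.received s r m t'

end Network

/-! ### Byzantine commit algorithms -/

/-- The observable part of one run of a Byzantine commit algorithm.
`accepts q ρ T t`: at time `t`, replica `q` accepts the transaction `T` proposed in round `ρ`;
`state q t`: the local state of `q` at time `t`. -/
structure CommitRun (n : ℕ) (Txn St : Type*) where
  accepts : Fin n → ℕ → Txn → ℕ → Prop
  state : Fin n → ℕ → St

/-- A Byzantine commit algorithm.
`wellFormed`: the check that replicas apply to states reported by others;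
`recover R`: the proposals (round and transaction) that can be recovered from the collection `R` of
local states, each labelled by its replica;
`runs faulty p`: the runs coordinated by the primary `p` when `faulty` are the faulty replicas. -/
structure CommitAlgorithm (n : ℕ) (Txn St : Type*) where
  wellFormed : St → Prop
  recover : Set (Fin n × St) → Finset (ℕ × Txn)
  runs : Finset (Fin n) → Fin n → Set (CommitRun n Txn St)

/-- The recovery guarantee of a Byzantine commit algorithm that tolerates `f` faulty replicas: once
a non-faulty replica has accepted `T` in round `ρ`, the proposal `(ρ, T)` can be recovered from the
states of any `nf - f` non-faulty replicas. -/
structure CommitAlgorithm.Recoverable {n : ℕ} {Txn St : Type*} (A : CommitAlgorithm n Txn St)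
    (f : ℕ) : Prop where
  wellFormed_state : ∀ faulty : Finset (Fin n), faulty.card ≤ f →
    ∀ p, ∀ R ∈ A.runs faulty p, ∀ q ∉ faulty, ∀ t, A.wellFormed (R.state q t)
  recoverable : ∀ faulty : Finset (Fin n), faulty.card ≤ f →
    ∀ p, ∀ R ∈ A.runs faulty p, ∀ q ∉ faulty, ∀ ρ T t, R.accepts q ρ T t →
      ∀ t' ≥ t, ∀ Q : Finset (Fin n), Disjoint Q faulty → Q.card = n - f - f →
        (ρ, T) ∈ A.recover ((fun r => (r, R.state r t')) '' (Q : Set (Fin n)))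

/-! ### Primary-backup consensus protocols -/

/-- The observable part of one run of a primary-backup consensus protocol deciding on one operation
of type `Op`.
`view q t`: the view of `q` at time `t`;
`waits q t`: at time `t`, the timer of `q` for this decision is running (so `q` will replace
leaders that do not bring the decision about);
`proposes q op t`: at time `t`, replica `q` proposes `op`;
`accepts q op t`: at time `t`, replica `q` accepts `op`. -/
structure ConsensusRun (n : ℕ) (Op Msg : Type*) where
  net : Network n Msg
  view : Fin n → ℕ → ℕ
  waits : Fin n → ℕ → Prop
  proposes : Fin n → Op → ℕ → Prop
  accepts : Fin n → Op → ℕ → Prop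

/-- Replica `q` has accepted an operation at or before time `t`. -/
def ConsensusRun.Done {n : ℕ} {Op Msg : Type*} (R : ConsensusRun n Op Msg) (q : Fin n) (t : ℕ) :
    Prop :=
  ∃ t' ≤ t, ∃ op, R.accepts q op t'

/-- A primary-backup protocol: the leader of each view, and `runs faulty valid`, its runs with
faulty replicas `faulty` in which non-faulty replicas check operations against `valid`. -/
structure PrimaryBackup (n : ℕ) (Op Msg : Type*) where
  leader : ℕ → Fin n
  runs : Finset (Fin n) → (Op → Prop) → Set (ConsensusRun n Op Msg)

/-- The protocol provides consensus in the presence of `f` faulty replicas: safety always (agreement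
and validity), progress once communication is reliable (totality and termination). -/
structure PrimaryBackup.IsConsensus {n : ℕ} {Op Msg : Type*} (P : PrimaryBackup n Op Msg) (f : ℕ) :
    Prop where
  /-- No two non-faulty replicas accept different operations. -/
  agreement : ∀ faulty : Finset (Fin n), faulty.card ≤ f → ∀ valid, ∀ R ∈ P.runs faulty valid,
    ∀ q ∉ faulty, ∀ q' ∉ faulty, ∀ op op' t t',
      R.accepts q op t → R.accepts q' op' t' → op = op'
  /-- Non-faulty replicas only accept valid operations. -/
  validity : ∀ faulty : Finset (Fin n), faulty.card ≤ f → ∀ valid, ∀ R ∈ P.runs faulty valid,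
    ∀ q ∉ faulty, ∀ op t, R.accepts q op t → valid op
  /-- What one non-faulty replica accepts, all non-faulty replicas eventually accept. -/
  totality : ∀ faulty : Finset (Fin n), faulty.card ≤ f → ∀ valid, ∀ R ∈ P.runs faulty valid,
    (∃ g Δ, R.net.ReliableFrom faulty g Δ) →
    ∀ q ∉ faulty, ∀ op t, R.accepts q op t → ∀ q' ∉ faulty, ∃ t', R.accepts q' op t'
  /-- If, from some time on, all undecided non-faulty replicas run their timer, and each of them that
  is the leader of its view has proposed a valid operation, then all non-faulty replicas eventually
  accept an operation. -/
  termination : ∀ faulty : Finset (Fin n), faulty.card ≤ f → ∀ valid, ∀ R ∈ P.runs faulty valid,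
    (∃ g Δ, R.net.ReliableFrom faulty g Δ) →
    (∃ t₁, ∀ q ∉ faulty, ∀ t ≥ t₁, ¬ R.Done q t →
      R.waits q t ∧
      (P.leader (R.view q t) = q → ∃ t' ≤ t, ∃ op, valid op ∧ R.proposes q op t')) →
    ∀ q ∉ faulty, ∃ t op, R.accepts q op t

/-! ### The recovery protocol -/

/-- The contents of a message `Failure(i, ρ, P)`. -/
structure Failure (m : ℕ) (St : Type*) where
  inst : Fin m
  round : ℕ
  state : St

/-- An operation `stop(i; E)`, with `E` a set of signed failure messages: a pair `(s, μ)` stands for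
the message `μ` with the signature of `s`. -/
structure Stop (n m : ℕ) (St : Type*) where
  inst : Fin m
  evidence : Finset (Fin n × Failure m St)

/-- A recovered state of an instance: its proposals, and the round in which it may resume (`⊥` if
there is no proposal from which to determine that round). -/
structure InstanceState (Txn : Type*) where
  log : Finset (ℕ × Txn)
  resume : WithBot ℕ

/-- The fixed data of the current incarnation of the instances: for each instance, the round in which
it last started, and how often it was stopped before. -/
structure Incarnation (m : ℕ) where
  start : Fin m → ℕ
  stops : Fin m → ℕ

/-- A run of the system with `m` instances.
`commit i`: the run of the Byzantine commit algorithm in instance `i`;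
`net`: the communication of `Failure` messages;
`detects i q ρ t`: at time `t`, replica `q` detects failure of the primary of `i` in round `ρ`;
`coord i`: the run of the coordinating consensus protocol of instance `i`;
`recovered i q t`: the state of instance `i` that `q` has recovered at time `t`, if any. -/
structure Run (n m : ℕ) (Txn St Msg : Type*) where
  commit : Fin m → CommitRun n Txn St
  net : Network n (Failure m St)
  detects : Fin m → Fin n → ℕ → ℕ → Prop
  coord : Fin m → ConsensusRun n (Stop n m St) Msg
  recovered : Fin m → Fin n → ℕ → Option (InstanceState Txn)

section

variable {n m : ℕ} {Txn St Msg : Type*}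

/-- `E` consists of `k` well-formed failure messages for instance `i`, from `k` distinct replicas,
none for a round before the one in which the instance last started. -/
def IsEvidence (A : CommitAlgorithm n Txn St) (c : Incarnation m) (i : Fin m) (k : ℕ)
    (E : Finset (Fin n × Failure m St)) : Prop :=
  E.card = k ∧ Set.InjOn Prod.fst (E : Set (Fin n × Failure m St)) ∧
    ∀ e ∈ E, e.2.inst = i ∧ A.wellFormed e.2.state ∧ c.start i ≤ e.2.round

/-- Replica `q` has received all messages in `E` at or before time `t`. -/
def Run.HasReceived (R : Run n m Txn St Msg) (q : Fin n) (E : Finset (Fin n × Failure m St))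
    (t : ℕ) : Prop :=
  ∀ e ∈ E, ∃ t' ≤ t, R.net.received e.1 q e.2 t'

/-- At time `t`, replica `q` has received `k` valid failure messages for `i` from `k` distinct
replicas. -/
def Run.HasFailures (R : Run n m Txn St Msg) (A : CommitAlgorithm n Txn St) (c : Incarnation m)
    (i : Fin m) (q : Fin n) (k t : ℕ) : Prop :=
  ∃ E, IsEvidence A c i k E ∧ R.HasReceived q E t

/-- Instance `i` has a confirmed failure: some non-faulty replica receives `nf` valid failure
messages for `i` from `nf` distinct replicas. -/
def Run.ConfirmedFailure (R : Run n m Txn St Msg) (A : CommitAlgorithm n Txn St)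
    (c : Incarnation m) (f : ℕ) (faulty : Finset (Fin n)) (i : Fin m) : Prop :=
  ∃ q ∉ faulty, ∃ t, R.HasFailures A c i q (n - f) t

/-- The validity check of `stop(i; E)`: `E` consists of `nf` valid failure messages from distinct
replicas, and the signatures are genuine: what is signed by a non-faulty replica was sent by it. -/
def Run.ValidStop (R : Run n m Txn St Msg) (A : CommitAlgorithm n Txn St) (c : Incarnation m)
    (f : ℕ) (faulty : Finset (Fin n)) (i : Fin m) (op : Stop n m St) : Prop :=
  op.inst = i ∧ IsEvidence A c i (n - f) op.evidence ∧
    ∀ e ∈ op.evidence, e.1 ∉ faulty → ∃ r t, R.net.sent e.1 r e.2 t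

open Classical in
/-- The proposals recovered from `E`: those that can be recovered from the states reported by some
`nf - f` of the senders. -/
noncomputable def recoverLog (A : CommitAlgorithm n Txn St) (f : ℕ)
    (E : Finset (Fin n × Failure m St)) : Finset (ℕ × Txn) :=
  (E.powersetCard (n - f - f)).biUnion fun E' =>
    A.recover ((fun e => (e.1, e.2.state)) '' (E' : Set (Fin n × Failure m St)))

/-- The state recovered from `stop(i; E)`: the recovered proposals, and the resume round
`ρ + 2 ^ k`, with `ρ` the last round with a recovered proposal and `k` the number of stop operations
accepted for the instance so far, the present one included. -/
noncomputable def recoverState (A : CommitAlgorithm n Txn St) (c : Incarnation m) (f : ℕ)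
    (op : Stop n m St) : InstanceState Txn where
  log := recoverLog A f op.evidence
  resume := ((recoverLog A f op.evidence).image Prod.fst).max.map (· + 2 ^ (c.stops op.inst + 1))

/-- `R` is a run of the concurrent system in which all non-faulty replicas follow the recovery
protocol.  The `i`-th replica is the primary of instance `i`. -/
structure Run.Follows (R : Run n m Txn St Msg) (A : CommitAlgorithm n Txn St)
    (P : PrimaryBackup n (Stop n m St) Msg) (c : Incarnation m) (f : ℕ) (faulty : Finset (Fin n))
    (hmn : m ≤ n) : Prop where
  commit_run : ∀ i, R.commit i ∈ A.runs faulty (Fin.castLE hmn i)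
  coord_run : ∀ i, R.coord i ∈ P.runs faulty (R.ValidStop A c f faulty i)
  authenticated : R.net.Authenticated faulty
  /-- Failures are detected in rounds of the current incarnation. -/
  detect_round : ∀ i, ∀ q ∉ faulty, ∀ ρ t, R.detects i q ρ t → c.start i ≤ ρ
  /-- A replica that detects a failure halts the instance: it accepts nothing later on, and its
  state of the instance no longer changes. -/
  detect_halt : ∀ i, ∀ q ∉ faulty, ∀ ρ t, R.detects i q ρ t → ∀ t' ≥ t,
    (R.commit i).state q t' = (R.commit i).state q t ∧
      ∀ ρ' T, (R.commit i).accepts q ρ' T t' → t' = t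
  /-- It broadcasts `Failure(i, ρ, P)`, with `P` its state, and it repeats this broadcast over and
  over until it accepts a stop operation. -/
  detect_broadcast : ∀ i, ∀ q ∉ faulty, ∀ ρ t, R.detects i q ρ t →
    (∀ r, R.net.sent q r ⟨i, ρ, (R.commit i).state q t⟩ t) ∧
      ∀ τ, ∃ t' ≥ τ, (R.coord i).Done q t' ∨
        ∀ r, R.net.sent q r ⟨i, ρ, (R.commit i).state q t⟩ t'
  /-- It sends no other failure messages. -/
  sent_detect : ∀ q ∉ faulty, ∀ r μ t, R.net.sent q r μ t →
    ∃ t' ≤ t, R.detects μ.inst q μ.round t' ∧ μ.state = (R.commit μ.inst).state q t'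
  /-- Having received `f + 1` valid failure messages, a replica detects failure (if not yet done). -/
  join : ∀ i, ∀ q ∉ faulty, ∀ t, R.HasFailures A c i q (f + 1) t →
    (R.coord i).Done q t ∨ ∃ t' ≤ t, ∃ ρ, R.detects i q ρ t'
  /-- Having received `nf` valid failure messages, a replica runs its timer for a stop operation. -/
  wait : ∀ i, ∀ q ∉ faulty, ∀ t, R.HasFailures A c i q (n - f) t →
    (R.coord i).Done q t ∨ (R.coord i).waits q t
  /-- Having received `nf` valid failure messages, the leader proposes `stop(i; E)`, with `E` a set
  of `nf` such messages. -/
  propose : ∀ i, ∀ q ∉ faulty, ∀ t, R.HasFailures A c i q (n - f) t →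
    P.leader ((R.coord i).view q t) = q →
    (R.coord i).Done q t ∨ ∃ t' ≤ t, ∃ E, IsEvidence A c i (n - f) E ∧ R.HasReceived q E t' ∧
      (R.coord i).proposes q ⟨i, E⟩ t'
  /-- On accepting a stop operation, a replica recovers the state of the instance from it. -/
  recover_accept : ∀ i, ∀ q ∉ faulty, ∀ op t, (R.coord i).accepts q op t →
    ∀ t' ≥ t, R.recovered i q t' = some (recoverState A c f op)
  /-- States are recovered in no other way. -/
  recover_only : ∀ i, ∀ q ∉ faulty, ∀ t S, R.recovered i q t = some S →
    ∃ t' ≤ t, ∃ op, (R.coord i).accepts q op t' ∧ S = recoverState A c f op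

/-- From time `g` on, the communication for the recovery of instance `i` (failure messages and the
messages of its coordinating protocol) is reliable, with maximal delay `Δ`. -/
def Run.ReliableFrom (R : Run n m Txn St Msg) (faulty : Finset (Fin n)) (i : Fin m) (g Δ : ℕ) :
    Prop :=
  R.net.ReliableFrom faulty g Δ ∧ (R.coord i).net.ReliableFrom faulty g Δ

end

end RCC

/-! Agreement makes all recovered states equal once every non-faulty replica accepts a stop
operation, so two things remain. Completeness (`mem_recoverLog`): among the `nf` signers of valid
evidence, at least `nf - f` are non-faulty. Each halted before reporting, so its report is its state
at all later times. The reports therefore form a snapshot at one arbitrarily late time, later than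
any given acceptance, and recoverability applies. Liveness (`exists_accepts`): if one non-faulty
replica accepts, totality suffices. Otherwise no broadcast ever ceases. The confirmed failure
involves `nf - f ≥ f + 1` non-faulty detectors, whose repeated messages make every non-faulty
replica detect (`all_detect`). Then all of them receive `nf` failure messages, and termination
applies. -/

namespace RCC

section

variable {n m f : ℕ} {Txn St Msg : Type*} {A : CommitAlgorithm n Txn St}
  {P : PrimaryBackup n (Stop n m St) Msg} {c : Incarnation m} {faulty : Finset (Fin n)}
  {R : Run n m Txn St Msg} {hmn : m ≤ n} {i : Fin m}

/-- Among `k` pieces of evidence, at least `k - f` are signed by non-faulty replicas. -/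
theorem IsEvidence.exists_nonfaulty_subset {k : ℕ} {E : Finset (Fin n × Failure m St)}
    (hE : IsEvidence A c i k E) (hfaulty : faulty.card ≤ f) :
    ∃ E' ⊆ E, E'.card = k - f ∧ ∀ e ∈ E', e.1 ∉ faulty := by
  classical
  obtain ⟨hcard, hinj, -⟩ := hE
  -- Signers are distinct, so each faulty replica accounts for at most one message.
  have hbad : (E.filter fun e => e.1 ∈ faulty).card ≤ faulty.card :=
    Finset.card_le_card_of_injOn Prod.fst (fun e he => (Finset.mem_filter.1 he).2)
      (hinj.mono fun e he => (Finset.mem_filter.1 he).1)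
  have hsum := E.card_filter_add_card_filter_not (fun e => e.1 ∈ faulty)
  obtain ⟨E', hsub, hE'⟩ := Finset.exists_subset_card_eq
    (show k - f ≤ (E.filter fun e => e.1 ∉ faulty).card by omega)
  exact ⟨E', hsub.trans (Finset.filter_subset _ _), hE',
    fun e he => (Finset.mem_filter.1 (hsub he)).2⟩

theorem Run.HasFailures.mono {q : Fin n} {k t t' : ℕ} (h : R.HasFailures A c i q k t)
    (ht : t ≤ t') : R.HasFailures A c i q k t' := by
  obtain ⟨E, hE, hrec⟩ := h
  refine ⟨E, hE, fun e he => ?_⟩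
  obtain ⟨s, hs, hr⟩ := hrec e he
  exact ⟨s, hs.trans ht, hr⟩

/-- A failure message signed by a non-faulty replica reports the final state of that replica. -/
theorem Run.Follows.eventually_state_eq (hR : R.Follows A P c f faulty hmn) {q r : Fin n}
    (hq : q ∉ faulty) {μ : Failure m St} {t : ℕ} (hsent : R.net.sent q r μ t) :
    ∀ᶠ t' in Filter.atTop, (R.commit μ.inst).state q t' = μ.state := by
  obtain ⟨s, -, hd, hst⟩ := hR.sent_detect q hq r μ t hsent
  filter_upwards [Filter.eventually_ge_atTop s] with t' ht'
  rw [hst, (hR.detect_halt _ q hq _ _ hd t' ht').1]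

/-- The proposals recovered from a valid stop operation include all proposals accepted by
non-faulty replicas. -/
theorem Run.Follows.mem_recoverLog (hR : R.Follows A P c f faulty hmn) (hA : A.Recoverable f)
    (hfaulty : faulty.card ≤ f) {op : Stop n m St} (hop : R.ValidStop A c f faulty i op)
    {q : Fin n} (hq : q ∉ faulty) {ρ : ℕ} {T : Txn} {t : ℕ}
    (hacc : (R.commit i).accepts q ρ T t) : (ρ, T) ∈ recoverLog A f op.evidence := by
  classical
  obtain ⟨-, hE, hsigned⟩ := hop
  obtain ⟨E', hsub, hcard, hgood⟩ := hE.exists_nonfaulty_subset hfaulty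
  -- The reports may stem from different times, whereas recoverability needs the states at a single
  -- time, not before `t`. Since halted states are frozen, any late enough time serves.
  have hstate : ∀ᶠ t' in Filter.atTop, ∀ e ∈ E', (R.commit i).state e.1 t' = e.2.state := by
    refine (Filter.eventually_all_finset E').2 fun e he => ?_
    obtain ⟨r, s, hs⟩ := hsigned e (hsub he) (hgood e he)
    have h := hR.eventually_state_eq (hgood e he) hs
    rwa [(hE.2.2 e (hsub he)).1] at h
  obtain ⟨t', hst, ht'⟩ := (hstate.and (Filter.eventually_ge_atTop t)).exists
  have hmem := hA.recoverable faulty hfaulty _ _ (hR.commit_run i) q hq ρ T t hacc t' ht'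
    (E'.image Prod.fst)
    (Finset.disjoint_left.2 fun r hr => by
      obtain ⟨e, he, rfl⟩ := Finset.mem_image.1 hr
      exact hgood e he)
    (by rw [Finset.card_image_of_injOn (hE.2.1.mono (Finset.coe_subset.2 hsub)), hcard])
  rw [Finset.coe_image, Set.image_image] at hmem
  refine Finset.mem_biUnion.2 ⟨E', Finset.mem_powersetCard.2 ⟨hsub, hcard⟩, ?_⟩
  convert hmem using 2
  exact Set.image_congr fun e he => by rw [hst e he]

/-- If the non-faulty replicas in `D` have detected failure and never accept a stop operation, then
every non-faulty replica eventually holds valid failure messages from all of them. -/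
theorem Run.Follows.eventually_hasFailures (hR : R.Follows A P c f faulty hmn)
    (hA : A.Recoverable f) (hfaulty : faulty.card ≤ f) {g Δ : ℕ}
    (hrel : R.net.ReliableFrom faulty g Δ) {D : Finset (Fin n)}
    (hD : ∀ q ∈ D, q ∉ faulty ∧ (∃ ρ t, R.detects i q ρ t) ∧ ∀ t, ¬ (R.coord i).Done q t)
    {r : Fin n} (hr : r ∉ faulty) :
    ∀ᶠ t in Filter.atTop, R.HasFailures A c i r D.card t := by
  classical
  have hmsg : ∀ q : D, ∃ μ : Failure m St,
      (μ.inst = i ∧ A.wellFormed μ.state ∧ c.start i ≤ μ.round) ∧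
        ∃ t, R.net.received q r μ t := by
    rintro ⟨q, hq⟩
    obtain ⟨hqf, ⟨ρ, t, hd⟩, hdone⟩ := hD q hq
    -- The first broadcast may precede `g` and be lost; a repetition at or after `g` must arrive.
    obtain ⟨t', ht', hsend⟩ := (hR.detect_broadcast i q hqf ρ t hd).2 g
    obtain ⟨s, -, -, hs⟩ := hrel q hqf r hr _ t' ht' (hsend.resolve_left (hdone t') r)
    exact ⟨_, ⟨rfl, hA.wellFormed_state faulty hfaulty _ _ (hR.commit_run i) q hqf t,
      hR.detect_round i q hqf ρ t hd⟩, s, hs⟩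
  choose μ hμ s hs using hmsg
  have hinj : Function.Injective fun q : D => ((q : Fin n), μ q) := fun a b h =>
    Subtype.ext (congrArg Prod.fst h)
  have hlate : ∀ᶠ t in Filter.atTop, ∀ q : D, s q ≤ t :=
    Filter.eventually_all.2 fun q => Filter.eventually_ge_atTop (s q)
  filter_upwards [hlate] with t ht
  refine ⟨Finset.univ.image fun q : D => ((q : Fin n), μ q), ⟨?_, ?_, ?_⟩, ?_⟩
  · rw [Finset.card_image_of_injective _ hinj, Finset.card_univ, Fintype.card_coe]
  · intro a ha b hb hab
    obtain ⟨a', -, rfl⟩ := Finset.mem_image.1 ha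
    obtain ⟨b', -, rfl⟩ := Finset.mem_image.1 hb
    rw [Subtype.ext hab]
  · intro e he
    obtain ⟨q, -, rfl⟩ := Finset.mem_image.1 he
    exact hμ q
  · intro e he
    obtain ⟨q, -, rfl⟩ := Finset.mem_image.1 he
    exact ⟨s q, ht q, hs q⟩

/-- The evidence that a replica has received is signed genuinely. -/
theorem Run.Follows.validStop (hR : R.Follows A P c f faulty hmn) {q : Fin n}
    {E : Finset (Fin n × Failure m St)} {t : ℕ} (hE : IsEvidence A c i (n - f) E)
    (hrec : R.HasReceived q E t) : R.ValidStop A c f faulty i ⟨i, E⟩ := by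
  refine ⟨rfl, hE, fun e he hef => ?_⟩
  obtain ⟨s, -, hs⟩ := hrec e he
  obtain ⟨s', -, hs'⟩ := hR.authenticated e.1 hef q e.2 s hs
  exact ⟨q, s', hs'⟩

/-- After a confirmed failure, if nobody accepted a stop operation, then every non-faulty replica
would detect the failure. -/
theorem Run.Follows.all_detect (hf : 3 * f < n) (hR : R.Follows A P c f faulty hmn)
    (hA : A.Recoverable f) (hfaulty : faulty.card ≤ f)
    (hconf : R.ConfirmedFailure A c f faulty i) {g Δ : ℕ}
    (hrel : R.net.ReliableFrom faulty g Δ)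
    (hdone : ∀ q ∉ faulty, ∀ t, ¬ (R.coord i).Done q t) {r : Fin n} (hr : r ∉ faulty) :
    ∃ ρ t, R.detects i r ρ t := by
  classical
  obtain ⟨q, hq, t, E, hE, hrec⟩ := hconf
  obtain ⟨E', hsub, hcard, hgood⟩ := hE.exists_nonfaulty_subset hfaulty
  -- This is where `n > 3f` is decisive: `nf - f = n - 2f ≥ f + 1`, the threshold for joining, which
  -- has to be met with exact cardinality.
  obtain ⟨E₁, hsub₁, hcard₁⟩ := Finset.exists_subset_card_eq (show f + 1 ≤ E'.card by omega)
  have hD : ∀ p ∈ E₁.image Prod.fst, p ∉ faulty ∧ (∃ ρ t, R.detects i p ρ t) ∧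
      ∀ t, ¬ (R.coord i).Done p t := by
    intro p hp
    obtain ⟨e, he, rfl⟩ := Finset.mem_image.1 hp
    have hef := hgood e (hsub₁ he)
    obtain ⟨s, -, hs⟩ := hrec e (hsub (hsub₁ he))
    obtain ⟨s', -, hs'⟩ := hR.authenticated e.1 hef q e.2 s hs
    obtain ⟨s'', -, hd, -⟩ := hR.sent_detect e.1 hef q e.2 s' hs'
    rw [(hE.2.2 e (hsub (hsub₁ he))).1] at hd
    exact ⟨hef, ⟨_, _, hd⟩, hdone e.1 hef⟩
  obtain ⟨t', ht'⟩ := (hR.eventually_hasFailures hA hfaulty hrel hD hr).exists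
  rw [Finset.card_image_of_injOn (hE.2.1.mono (Finset.coe_subset.2 (hsub₁.trans hsub))),
    hcard₁] at ht'
  obtain ⟨s, -, ρ, hd⟩ := (hR.join i r hr t' ht').resolve_left (hdone r hr t')
  exact ⟨ρ, s, hd⟩

/-- After a confirmed failure, all non-faulty replicas eventually accept a stop operation. -/
theorem Run.Follows.exists_accepts (hf : 3 * f < n) (hR : R.Follows A P c f faulty hmn)
    (hA : A.Recoverable f) (hP : P.IsConsensus f) (hfaulty : faulty.card ≤ f)
    (hconf : R.ConfirmedFailure A c f faulty i) (hrel : ∃ g Δ, R.ReliableFrom faulty i g Δ) :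
    ∀ q ∉ faulty, ∃ t op, (R.coord i).accepts q op t := by
  classical
  obtain ⟨g, Δ, hnet, hcoord⟩ := hrel
  -- Replicas that accept may stop broadcasting, so the message-counting argument is only run when
  -- nobody accepts.
  by_cases hsome : ∃ q ∉ faulty, ∃ t, (R.coord i).Done q t
  · obtain ⟨q, hq, -, t, -, op, hacc⟩ := hsome
    intro q' hq'
    obtain ⟨t', h⟩ := hP.totality faulty hfaulty _ _ (hR.coord_run i) ⟨g, Δ, hcoord⟩ q hq op t
      hacc q' hq'
    exact ⟨t', op, h⟩
  push Not at hsome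
  -- There may be more than `nf` non-faulty replicas; exactly `nf` are selected because evidence has
  -- a prescribed size.
  obtain ⟨D, hDsub, hDcard⟩ := Finset.exists_subset_card_eq
    (show n - f ≤ faultyᶜ.card by rw [Finset.card_compl, Fintype.card_fin]; omega)
  have hD : ∀ q ∈ D, q ∉ faulty ∧ (∃ ρ t, R.detects i q ρ t) ∧ ∀ t, ¬ (R.coord i).Done q t :=
    fun q hq =>
      have hqf := Finset.mem_compl.1 (hDsub hq)
      ⟨hqf, hR.all_detect hf hA hfaulty hconf hnet hsome hqf, hsome q hqf⟩
  -- Termination asks for one time bound common to all replicas; it exists as there are finitely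
  -- many.
  have hall : ∀ᶠ t in Filter.atTop, ∀ r, r ∉ faulty → R.HasFailures A c i r (n - f) t := by
    refine Filter.eventually_all.2 fun r => ?_
    by_cases hr : r ∈ faulty
    · exact Filter.Eventually.of_forall fun _ h => absurd hr h
    · filter_upwards [hR.eventually_hasFailures hA hfaulty hnet hD hr] with t ht _
      rwa [hDcard] at ht
  obtain ⟨t₁, ht₁⟩ := Filter.eventually_atTop.1 hall
  refine hP.termination faulty hfaulty _ _ (hR.coord_run i) ⟨g, Δ, hcoord⟩
    ⟨t₁, fun q hq t ht hnd => ⟨(hR.wait i q hq t (ht₁ t ht q hq)).resolve_left hnd, fun hl => ?_⟩⟩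
  obtain ⟨t', ht', E, hE, hrec, hprop⟩ :=
    (hR.propose i q hq t (ht₁ t ht q hq) hl).resolve_left hnd
  exact ⟨t', ht', _, hR.validStop hE hrec, hprop⟩

end

end RCC

theorem mainTheorem2 {n m f : ℕ} {Txn St Msg : Type*} (hf : 3 * f < n) (hmn : m ≤ n)
    (A : RCC.CommitAlgorithm n Txn St) (hA : A.Recoverable f)
    (P : RCC.PrimaryBackup n (RCC.Stop n m St) Msg) (hP : P.IsConsensus f)
    (c : RCC.Incarnation m) (faulty : Finset (Fin n)) (hfaulty : faulty.card ≤ f)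
    (R : RCC.Run n m Txn St Msg) (hR : R.Follows A P c f faulty hmn)
    (i : Fin m) (hconf : R.ConfirmedFailure A c f faulty i)
    (hrel : ∃ g Δ, R.ReliableFrom faulty i g Δ) :
    ∃ S : RCC.InstanceState Txn,
      (∃ t₀, ∀ t ≥ t₀, ∀ q ∉ faulty, R.recovered i q t = some S) ∧
      ∀ q ∉ faulty, ∀ ρ T t, (R.commit i).accepts q ρ T t → (ρ, T) ∈ S.log := by
  have hacc := hR.exists_accepts hf hA hP hfaulty hconf hrel
  obtain ⟨q₀, hq₀⟩ : ∃ q, q ∉ faulty := by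
    by_contra! h
    have := Finset.card_le_card (fun q _ => h q : Finset.univ ⊆ faulty)
    rw [Finset.card_univ, Fintype.card_fin] at this
    omega
  obtain ⟨s₀, op, hop⟩ := hacc q₀ hq₀
  refine ⟨RCC.recoverState A c f op, ?_, fun q hq ρ T t h => hR.mem_recoverLog hA hfaulty
    (hP.validity faulty hfaulty _ _ (hR.coord_run i) q₀ hq₀ op s₀ hop) hq h⟩
  refine Filter.eventually_atTop.1 (Filter.eventually_all.2 fun q => ?_)
  by_cases hq : q ∈ faulty
  · exact Filter.Eventually.of_forall fun _ h => absurd hq h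
  · obtain ⟨s, op', hop'⟩ := hacc q hq
    obtain rfl := hP.agreement faulty hfaulty _ _ (hR.coord_run i) q hq q₀ hq₀ op' op s s₀ hop' hop
    filter_upwards [Filter.eventually_ge_atTop s] with t ht _
    exact hR.recover_accept i q hq op' s hop' t ht
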